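/- Let $V$ be a finite-dimensional real inner product space. A hyperplane of $V$ is a linear subspace of codimension $1$; the reflection $s_H$ along a hyperplane $H$ is the linear map that is the identity on $H$ and $-1$ on $H^\perp$. Let $\mathcal H$ be a set of hyperplanes of $V$ such that the subgroup $W=\langle s_H : H\in\mathcal H\rangle\le GL(V)$ is finite and such that $\mathcal H$ is $W$-invariant, i.e. $wH\in\mathcal H$ for all $w\in W$, $H\in\mathcal H$. Let $C$ be a chamber, i.e. a connected component of $V\setminus\bigcup_{H\in\mathcal H}H$. A wall of $C$ is a hyperplane that is the linear span of a codimension-$1$ face of the closed convex cone $\overline C$ (a face being the nonempty set of points of $\overline C$ at which some linear functional attains its maximum over $\overline C$). 1. $W$ is generated by the reflections $s_H$ along the walls $H$ of $C$. 2. Suppose that $\dim V=r$ and that $C$ has exactly $r$ walls, $H_1,\dots,H_r$ (distinct). Let $s_i=s_{H_i}$, and let $e_i$ be the unit normal of $H_i$ that points to the side of $C$, i.e. $e_i\perp H_i$, $\|e_i\|=1$ and $\langle e_i,x\rangle>0$ for all $x\in C$. Then for all $1\le i,j\le r$, $$\langle e_i,e_j\rangle=-\cos\left(\frac{\pi}{m_{ij}}\right),$$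 where $m_{ij}$ is the order of $s_is_j$. -/

import Mathlib

open scoped RealInnerProductSpace

noncomputable section

namespace ReflectionChambers

variable {V : Type*} [NormedAddCommGroup V] [InnerProductSpace ℝ V]

/-- A hyperplane: a linear subspace of codimension `1`. -/
def IsHyperplane (H : Submodule ℝ V) : Prop :=
  Module.finrank ℝ (V ⧸ H) = 1

/-- The reflection `s_H` along `H`, as an element of the general linear group of `V`. -/
def refl [FiniteDimensional ℝ V] (H : Submodule ℝ V) : V ≃ₗ[ℝ] V :=
  H.reflection.toLinearEquiv

/-- `s_H` is the identity on `H`. -/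
theorem refl_apply_of_mem [FiniteDimensional ℝ V] {H : Submodule ℝ V} {v : V} (hv : v ∈ H) :
    refl H v = v :=
  Submodule.reflection_mem_subspace_eq_self hv

/-- `s_H` is multiplication by `-1` on the orthogonal complement of `H`. -/
theorem refl_apply_of_mem_orthogonal [FiniteDimensional ℝ V] {H : Submodule ℝ V} {v : V}
    (hv : v ∈ Hᗮ) : refl H v = -v :=
  Submodule.reflection_mem_subspace_orthogonalComplement_eq_neg hv

/-- The group generated by the reflections along the members of `𝓗`. -/
def reflectionGroup [FiniteDimensional ℝ V] (𝓗 : Set (Submodule ℝ V)) : Subgroup (V ≃ₗ[ℝ] V) :=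
  Subgroup.closure {s | ∃ H ∈ 𝓗, s = refl H}

/-- `𝓗` is stable under the action of `W` on subspaces. -/
def IsInvariant (W : Subgroup (V ≃ₗ[ℝ] V)) (𝓗 : Set (Submodule ℝ V)) : Prop :=
  ∀ w ∈ W, ∀ H ∈ 𝓗, H.map (w : V →ₗ[ℝ] V) ∈ 𝓗

/-- The complement `V - ⋃_{H ∈ 𝓗} H` of the arrangement `𝓗`. -/
def arrangementComplement (𝓗 : Set (Submodule ℝ V)) : Set V :=
  {v | ∀ H ∈ 𝓗, v ∉ H}

/-- A chamber: a connected component of the complement of the arrangement. -/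
def IsChamber (𝓗 : Set (Submodule ℝ V)) (C : Set V) : Prop :=
  ∃ x ∈ arrangementComplement 𝓗, C = connectedComponentIn (arrangementComplement 𝓗) x

/-- `H` is a wall of `C`: a hyperplane spanned by a (nonempty) face of the closed cone
`closure C`, that is, the support of a face of codimension `1`. A face is a set of the form
`{x ∈ closure C | l x = max of l on closure C}`, with `l` a linear functional. -/
def IsWall (C : Set V) (H : Submodule ℝ V) : Prop :=
  IsHyperplane H ∧
    ∃ F : Set V, F.Nonempty ∧ IsExposed ℝ (closure C) F ∧ Submodule.span ℝ F = H

/-- `e` is the unit normal of `H` pointing to the side of `H` that contains `C`. -/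
def IsInwardUnitNormal (C : Set V) (H : Submodule ℝ V) (e : V) : Prop :=
  e ∈ Hᗮ ∧ ‖e‖ = 1 ∧ ∀ x ∈ C, 0 < ⟪e, x⟫

end ReflectionChambers

end

/-! ### Unit normals and reflections -/

noncomputable section

namespace ReflectionChambers

variable {V : Type*} [NormedAddCommGroup V] [InnerProductSpace ℝ V]

/-! Finiteness of $W$ makes $\mathcal H$ finite, so $C$ is an open polyhedral cone cut out by the
unit normals positive on it (`IsChamber.eq_openCone`), and its walls lie in $\mathcal H$.

Generation: let $W'$ be generated by the wall reflections. Fix $p \in C$. If $\langle wy, p\rangle$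
is maximal over $w \in W'$, then $wy \in \overline C$, since reflecting in a violated wall would
increase it. For $H \in \mathcal H$, take $y \in H$ on no other member. Then $wy \in \overline C$
lies on $wH$ alone, so $wH$ is a wall and $s_H = w^{-1} s_{wH} w \in W'$.

Angles: let $a, b$ be inward normals of distinct walls, with $\langle a, b\rangle = -\cos t$.
Rotating $-a$ and $b$ by powers of $s_b s_a$ gives roots at all multiples of $t$ from $-a$. None
changes sign on $C$, which forces $t = \pi/m$ (`exists_eq_pi_div_of_sin_mul_sin_nonneg`). The
rotation by $2\pi/m$ then has order $m$. -/

theorem mem_perp {a v : V} : v ∈ (ℝ ∙ a)ᗮ ↔ ⟪a, v⟫ = 0 :=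
  Submodule.mem_orthogonal_singleton_iff_inner_right

theorem inner_self_of_norm_eq_one {a : V} (ha : ‖a‖ = 1) : ⟪a, a⟫ = 1 := by
  rw [real_inner_self_eq_norm_sq, ha, one_pow]

theorem perp_neg (a : V) : (ℝ ∙ (-a))ᗮ = (ℝ ∙ a)ᗮ := by
  ext v
  simp [mem_perp]

/-- Unit vectors with nested orthogonal hyperplanes agree up to sign. -/
theorem eq_or_eq_neg_of_perp_le {a b : V} (ha : ‖a‖ = 1) (hb : ‖b‖ = 1)
    (h : (ℝ ∙ a)ᗮ ≤ (ℝ ∙ b)ᗮ) : b = a ∨ b = -a := by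
  have haa := inner_self_of_norm_eq_one ha
  have hbb := inner_self_of_norm_eq_one hb
  have h1 : b - ⟪a, b⟫ • a ∈ (ℝ ∙ a)ᗮ := by
    rw [mem_perp, inner_sub_right, inner_smul_right, haa]
    ring
  have h2 := mem_perp.1 (h h1)
  rw [inner_sub_right, inner_smul_right, hbb, real_inner_comm] at h2
  have h3 : b - ⟪a, b⟫ • a = 0 := by
    rw [← inner_self_eq_zero (𝕜 := ℝ), inner_sub_left, inner_smul_left, mem_perp.1 h1,
      inner_sub_right, inner_smul_right, hbb, real_inner_comm a b]
    simpa [real_inner_comm] using h2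
  have h4 : ⟪a, b⟫ = 1 ∨ ⟪a, b⟫ = -1 := by
    rw [← sq_eq_one_iff]
    rw [real_inner_comm] at h2
    linarith [sq ⟪a, b⟫]
  rcases h4 with h4 | h4 <;> rw [h4] at h3
  · left; simpa [sub_eq_zero] using h3
  · right; simpa [add_eq_zero_iff_eq_neg] using h3

section FiniteDimensional

variable [FiniteDimensional ℝ V]

theorem refl_perp_apply {a : V} (ha : ‖a‖ = 1) (v : V) :
    refl (ℝ ∙ a)ᗮ v = v - (2 * ⟪a, v⟫) • a := by
  change (ℝ ∙ a)ᗮ.reflection v = _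
  rw [Submodule.reflection_orthogonal_apply, Submodule.reflection_singleton_apply]
  simp [ha, mul_smul, two_smul]

theorem refl_mul_self (H : Submodule ℝ V) : refl H * refl H = 1 := by
  ext v
  exact H.reflection_reflection v

theorem refl_eq_self_iff {H : Submodule ℝ V} {v : V} : refl H v = v ↔ v ∈ H :=
  Submodule.reflection_eq_self_iff v

theorem refl_injective : Function.Injective (refl : Submodule ℝ V → V ≃ₗ[ℝ] V) := by
  intro H K h
  ext v
  rw [← refl_eq_self_iff, h, refl_eq_self_iff]

theorem inner_refl_refl (H : Submodule ℝ V) (x y : V) : ⟪refl H x, refl H y⟫ = ⟪x, y⟫ :=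
  H.reflection.inner_map_map x y

theorem IsHyperplane.exists_unit_normal {H : Submodule ℝ V} (hH : IsHyperplane H) :
    ∃ a : V, ‖a‖ = 1 ∧ H = (ℝ ∙ a)ᗮ := by
  have h1 : Module.finrank ℝ Hᗮ = 1 := by
    have h2 := H.finrank_add_finrank_orthogonal
    have h3 := H.finrank_quotient_add_finrank
    rw [IsHyperplane] at hH
    omega
  obtain ⟨⟨v, hv⟩, hv0, hv1⟩ := finrank_eq_one_iff'.1 h1
  have hv0' : v ≠ 0 := fun h => hv0 (Subtype.ext h)
  refine ⟨‖v‖⁻¹ • v, norm_smul_inv_norm hv0', ?_⟩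
  have h2 : Hᗮ = ℝ ∙ v := by
    refine le_antisymm (fun w hw => ?_) ((Submodule.span_singleton_le_iff_mem _ _).2 hv)
    obtain ⟨c, hc⟩ := hv1 ⟨w, hw⟩
    exact Submodule.mem_span_singleton.2 ⟨c, congrArg Subtype.val hc⟩
  rw [Submodule.span_singleton_smul_eq (by simpa using hv0'), ← h2,
    Submodule.orthogonal_orthogonal]

theorem isHyperplane_perp {a : V} (ha : a ≠ 0) : IsHyperplane (ℝ ∙ a)ᗮ := by
  have h2 := (ℝ ∙ a).finrank_add_finrank_orthogonal
  have h3 := (ℝ ∙ a)ᗮ.finrank_quotient_add_finrank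
  rw [finrank_span_singleton ha] at h2
  rw [IsHyperplane]
  omega

theorem not_isHyperplane_top : ¬ IsHyperplane (⊤ : Submodule ℝ V) := by
  intro h
  have h3 := (⊤ : Submodule ℝ V).finrank_quotient_add_finrank
  rw [finrank_top] at h3
  rw [IsHyperplane] at h
  omega

end FiniteDimensional

/-! ### Polyhedral cones and their walls -/

/-- The open polyhedral cone on which all members of `A` are positive. -/
def openCone (A : Set V) : Set V :=
  {x | ∀ a ∈ A, 0 < ⟪a, x⟫}

theorem convex_openCone (A : Set V) : Convex ℝ (openCone A) := by
  intro x hx y hy s t hs ht hst a ha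
  rw [inner_add_right, inner_smul_right, inner_smul_right]
  have h1 := hx a ha
  have h2 := hy a ha
  rcases hs.eq_or_lt with rfl | hs
  · rw [zero_add] at hst
    simpa [hst] using h2
  · positivity

theorem exists_add_smul_mem_openCone {A : Set V} (hA : A.Finite) {x : V} (hx : x ∈ openCone A)
    (v : V) : ∃ ε : ℝ, 0 < ε ∧ x + ε • v ∈ openCone A := by
  have h : ∀ᶠ ε : ℝ in nhdsWithin 0 (Set.Ioi 0), ∀ a ∈ A, 0 < ⟪a, x + ε • v⟫ := by
    rw [Set.Finite.eventually_all hA]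
    intro a ha
    have hc : Continuous fun ε : ℝ => ⟪a, x + ε • v⟫ := by fun_prop
    refine (hc.tendsto 0).mono_left nhdsWithin_le_nhds |>.eventually_const_lt ?_
    simpa using hx a ha
  obtain ⟨ε, h1, h2⟩ := (h.and self_mem_nhdsWithin).exists
  exact ⟨ε, h2, h1⟩

/-- A point satisfying the weak inequalities enters the open cone when pushed along `p`. Without
such a `p` the open cone could be empty and the equality false. -/
theorem closure_openCone {A : Set V} {p : V} (hp : p ∈ openCone A) :
    closure (openCone A) = {x | ∀ a ∈ A, 0 ≤ ⟪a, x⟫} := by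
  refine Set.Subset.antisymm (closure_minimal (fun x hx a ha => (hx a ha).le) ?_) fun x hx => ?_
  · simp only [Set.ofPred_forall]
    exact isClosed_biInter fun a _ => isClosed_le continuous_const (by fun_prop)
  · have hc : Continuous fun ε : ℝ => x + ε • p := by fun_prop
    have ht : Filter.Tendsto (fun ε : ℝ => x + ε • p) (nhdsWithin 0 (Set.Ioi 0)) (nhds x) := by
      simpa using (hc.tendsto 0).mono_left nhdsWithin_le_nhds
    refine mem_closure_of_tendsto ht ?_
    filter_upwards [self_mem_nhdsWithin] with ε hε a ha
    rw [inner_add_right, inner_smul_right]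
    exact add_pos_of_nonneg_of_pos (hx a ha) (mul_pos hε (hp a ha))

theorem span_eq_top_of_openCone_subset {A F : Set V} (hA : A.Finite) {p : V} (hp : p ∈ openCone A)
    (hF : openCone A ⊆ F) : Submodule.span ℝ F = ⊤ := by
  refine eq_top_iff.2 fun v _ => ?_
  obtain ⟨ε, hε, h⟩ := exists_add_smul_mem_openCone hA hp v
  have h2 : v = ε⁻¹ • ((p + ε • v) - p) := by
    rw [add_sub_cancel_left, smul_smul, inv_mul_cancel₀ hε.ne', one_smul]
  rw [h2]
  exact Submodule.smul_mem _ _ (Submodule.sub_mem _ (Submodule.subset_span (hF h))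
    (Submodule.subset_span (hF hp)))

section Walls

variable [FiniteDimensional ℝ V]

/-- The point `z` is relatively interior to the face on which `a` vanishes: a small move from `z` in
any direction orthogonal to `a` stays in that face, so the face spans the hyperplane. -/
theorem isWall_openCone {A : Set V} (hA : A.Finite) {p a z : V} (hp : p ∈ openCone A) (ha : a ∈ A)
    (hz : ⟪a, z⟫ = 0) (hz' : ∀ b ∈ A, b ≠ a → 0 < ⟪b, z⟫) :
    IsWall (openCone A) (ℝ ∙ a)ᗮ := by
  have ha0 : a ≠ 0 := by
    rintro rfl
    simpa using hp _ ha
  have hmem : ∀ {y : V}, ⟪a, y⟫ = 0 → (∀ b ∈ A, b ≠ a → 0 < ⟪b, y⟫) →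
      y ∈ closure (openCone A) := by
    intro y h1 h2
    rw [closure_openCone hp]
    intro b hb
    by_cases hba : b = a
    · rw [hba, h1]
    · exact (h2 b hb hba).le
  have hzF := hmem hz hz'
  refine ⟨isHyperplane_perp ha0, {x ∈ closure (openCone A) | ⟪a, x⟫ = 0}, ⟨z, hzF, hz⟩,
    fun _ => ⟨-innerSL ℝ a, ?_⟩, le_antisymm (Submodule.span_le.2 fun x hx => mem_perp.2 hx.2)
    fun v hv => ?_⟩
  · ext x
    simp only [Set.mem_ofPred_eq, neg_apply, innerSL_apply_apply, neg_le_neg_iff]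
    refine and_congr_right fun hx => ⟨fun h y hy => ?_, fun h => le_antisymm ?_ ?_⟩
    · rw [closure_openCone hp] at hy
      exact h.trans_le (hy a ha)
    · exact (h z hzF).trans_eq hz
    · rw [closure_openCone hp] at hx
      exact hx a ha
  · have hz1 : z ∈ openCone (A \ {a}) := fun b hb => hz' b hb.1 hb.2
    obtain ⟨ε, hε, h⟩ := exists_add_smul_mem_openCone (hA.sdiff (t := {a})) hz1 v
    have h0 : ⟪a, z + ε • v⟫ = 0 := by
      rw [inner_add_right, inner_smul_right, hz, mem_perp.1 hv]
      ring
    have h1 : z + ε • v ∈ closure (openCone A) := hmem h0 fun b hb hba => h b ⟨hb, hba⟩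
    have h2 : v = ε⁻¹ • ((z + ε • v) - z) := by
      rw [add_sub_cancel_left, smul_smul, inv_mul_cancel₀ hε.ne', one_smul]
    rw [h2]
    exact Submodule.smul_mem _ _ (Submodule.sub_mem _ (Submodule.subset_span ⟨h1, h0⟩)
      (Submodule.subset_span ⟨hzF, hz⟩))

/-- If no member of `A` vanished on the whole face, a sum of points of the face would be interior to
the cone. A functional maximal at an interior point with value 0 is zero, so the face would be the
whole closed cone and span `V`. -/
theorem IsWall.exists_eq_perp {A : Set V} (hA : A.Finite) {p : V} (hp : p ∈ openCone A)
    {H : Submodule ℝ V} (hH : IsWall (openCone A) H) : ∃ a ∈ A, H = (ℝ ∙ a)ᗮ := by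
  obtain ⟨hyp, F, hne, hexp, hspan⟩ := hH
  obtain ⟨l, hl⟩ := hexp hne
  have hcl := closure_openCone hp
  have hFc : ∀ {x}, x ∈ F → ∀ a ∈ A, 0 ≤ ⟪a, x⟫ := by
    intro x hx
    rw [hl, hcl] at hx
    exact hx.1
  have hFl : ∀ {x}, x ∈ F → ∀ y, (∀ a ∈ A, 0 ≤ ⟪a, y⟫) → l y ≤ l x := by
    intro x hx
    rw [hl, hcl] at hx
    exact hx.2
  have hF0 : ∀ {x}, x ∈ F → l x = 0 := by
    intro x hx
    -- The closed cone contains $0$ and $2x$, so the maximum can only be $0$.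
    have h1 := hFl hx 0 (by simp)
    have h2 := hFl hx (x + x) fun a ha => by
      rw [inner_add_right]
      exact add_nonneg (hFc hx a ha) (hFc hx a ha)
    rw [map_add] at h2
    rw [map_zero] at h1
    linarith
  have hFm : ∀ {x}, (∀ a ∈ A, 0 ≤ ⟪a, x⟫) → l x = 0 → x ∈ F := by
    intro x hx h0
    rw [hl, hcl]
    obtain ⟨y, hy⟩ := hne
    exact ⟨hx, fun z hz => (hFl hy z hz).trans_eq ((hF0 hy).trans h0.symm)⟩
  by_cases hex : ∃ a ∈ A, ∀ x ∈ F, ⟪a, x⟫ = 0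
  · obtain ⟨a, ha, h⟩ := hex
    have ha0 : a ≠ 0 := by
      rintro rfl
      simpa using hp _ ha
    refine ⟨a, ha, ?_⟩
    have hle : H ≤ (ℝ ∙ a)ᗮ := by
      rw [← hspan, Submodule.span_le]
      exact fun x hx => mem_perp.2 (h x hx)
    refine Submodule.eq_of_le_of_finrank_eq hle ?_
    have h1 := H.finrank_quotient_add_finrank
    have h2 := (ℝ ∙ a)ᗮ.finrank_quotient_add_finrank
    have h3 := isHyperplane_perp ha0
    rw [IsHyperplane] at hyp h3
    omega
  · exfalso
    push Not at hex
    have key : ∃ x ∈ F, ∀ a ∈ A, 0 < ⟪a, x⟫ := by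
      refine hA.induction_on_subset (motive := fun S _ => ∃ x ∈ F, ∀ a ∈ S, 0 < ⟪a, x⟫) _ ?_ ?_
      · obtain ⟨y, hy⟩ := hne
        exact ⟨y, hy, by simp⟩
      · rintro a S ha hS - ⟨x, hx, hxS⟩
        obtain ⟨y, hy, hay⟩ := hex a ha
        refine ⟨x + y, hFm (fun b hb => ?_) ?_, ?_⟩
        · rw [inner_add_right]
          exact add_nonneg (hFc hx b hb) (hFc hy b hb)
        · rw [map_add, hF0 hx, hF0 hy, add_zero]
        · rintro b (rfl | hb)
          · rw [inner_add_right]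
            exact add_pos_of_nonneg_of_pos (hFc hx b ha) ((hFc hy b ha).lt_of_ne' hay)
          · rw [inner_add_right]
            exact add_pos_of_pos_of_nonneg (hxS b hb) (hFc hy b (hS hb))
    obtain ⟨x, hx, hxA⟩ := key
    have hl0 : ∀ v, l v ≤ 0 := by
      intro v
      obtain ⟨ε, hε, h⟩ := exists_add_smul_mem_openCone hA hxA v
      have h1 := hFl hx _ fun a ha => (h a ha).le
      rw [map_add, map_smul, smul_eq_mul] at h1
      by_contra! hv
      have := mul_pos hε hv
      linarith
    have hsub : openCone A ⊆ F := fun y hy => hFm (fun a ha => (hy a ha).le)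
      (le_antisymm (hl0 y) (by simpa using hl0 (-y)))
    rw [← hspan, span_eq_top_of_openCone_subset hA hp hsub] at hyp
    exact not_isHyperplane_top hyp

/-- A point outside the closed cone violates the inequality of one of the walls. -/
theorem exists_isWall_inner_neg {A : Set V} (hA : A.Finite) {p : V} (hp : p ∈ openCone A) {x : V}
    (hx : x ∉ closure (openCone A)) :
    ∃ a ∈ A, IsWall (openCone A) (ℝ ∙ a)ᗮ ∧ ⟪a, x⟫ < 0 := by
  -- Discard redundant inequalities: in a minimal system for the same cone, each one defines a wall.
  obtain ⟨B, hBA, hB⟩ := Set.Finite.exists_le_minimal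
    (s := {B | B ⊆ A ∧ openCone B = openCone A})
    (hA.finite_subsets.subset fun B hB => hB.1) (show A ∈ _ from ⟨subset_rfl, rfl⟩)
  obtain ⟨⟨-, hBc⟩, hmin⟩ := hB
  have hBf := hA.subset hBA
  rw [← hBc] at hp hx ⊢
  rw [closure_openCone hp] at hx
  simp only [Set.mem_ofPred_eq, not_forall, not_le] at hx
  obtain ⟨a, haB, hax⟩ := hx
  refine ⟨a, hBA haB, ?_, hax⟩
  obtain ⟨v, hv, hva⟩ : ∃ v ∈ openCone (B \ {a}), ⟪a, v⟫ ≤ 0 := by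
    by_contra! h
    have h1 : openCone (B \ {a}) = openCone B := by
      refine Set.Subset.antisymm (fun v hv b hb => ?_) fun v hv b hb => hv b hb.1
      by_cases hba : b = a
      · exact hba ▸ h v hv
      · exact hv b ⟨hb, hba⟩
    exact (hmin ⟨Set.sdiff_subset.trans hBA, h1.trans hBc⟩ Set.sdiff_subset haB).2 rfl
  have hpa := hp a haB
  -- Up to a positive factor, `z` is the point where the segment from `p` to `v` meets the
  -- hyperplane orthogonal to `a`.
  refine isWall_openCone hBf (z := ⟪a, p⟫ • v + (-⟪a, v⟫) • p) hp haB ?_ fun b hb hba => ?_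
  · rw [inner_add_right, inner_smul_right, inner_smul_right]
    ring
  · rw [inner_add_right, inner_smul_right, inner_smul_right]
    exact add_pos_of_pos_of_nonneg (mul_pos hpa (hv b ⟨hb, hba⟩))
      (mul_nonneg (neg_nonneg.2 hva) (hp b hb).le)

end Walls

/-! ### Roots and chambers -/

/-- A unit normal vector of a member of `𝓗`. -/
def IsRoot (𝓗 : Set (Submodule ℝ V)) (a : V) : Prop :=
  ‖a‖ = 1 ∧ (ℝ ∙ a)ᗮ ∈ 𝓗

/-- The unit normals of members of `𝓗` that are positive on `C`. -/
def positiveRoots (𝓗 : Set (Submodule ℝ V)) (C : Set V) : Set V :=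
  {a | IsRoot 𝓗 a ∧ ∀ x ∈ C, 0 < ⟪a, x⟫}

theorem IsRoot.neg {𝓗 : Set (Submodule ℝ V)} {a : V} (ha : IsRoot 𝓗 a) : IsRoot 𝓗 (-a) := by
  rw [IsRoot, norm_neg, perp_neg]
  exact ha

theorem forall_pos_or_forall_neg_of_isPreconnected {C : Set V} (hC : IsPreconnected C) {a : V}
    (h : ∀ x ∈ C, ⟪a, x⟫ ≠ 0) : (∀ x ∈ C, 0 < ⟪a, x⟫) ∨ ∀ x ∈ C, ⟪a, x⟫ < 0 := by
  by_contra! hcon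
  obtain ⟨⟨x, hx, hx0⟩, y, hy, hy0⟩ := hcon
  obtain ⟨z, hz, hz0⟩ := hC.intermediate_value hx hy (f := fun v => ⟪a, v⟫) (by fun_prop)
    ⟨hx0, hy0⟩
  exact h z hz hz0

theorem map_perp {w : V ≃ₗ[ℝ] V} (hw : ∀ x y, ⟪w x, w y⟫ = ⟪x, y⟫) (a : V) :
    (ℝ ∙ a)ᗮ.map (w : V →ₗ[ℝ] V) = (ℝ ∙ (w a))ᗮ := by
  ext v
  rw [Submodule.mem_map, mem_perp]
  constructor
  · rintro ⟨x, hx, rfl⟩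
    exact (hw a x).trans (mem_perp.1 hx)
  · intro h
    refine ⟨w.symm v, mem_perp.2 ?_, w.apply_symm_apply v⟩
    rw [← hw, w.apply_symm_apply, h]

/-- A point of a hyperplane that lies on no other member of a finite set of hyperplanes. -/
theorem exists_mem_forall_notMem {𝓗 : Set (Submodule ℝ V)} {H : Submodule ℝ V} (hfin : 𝓗.Finite)
    (h : ∀ K ∈ 𝓗, H ≤ K → K = H) : ∃ y ∈ H, ∀ K ∈ 𝓗, y ∈ K → K = H := by
  by_contra! hcon
  have hf : Finite {K // K ∈ 𝓗 ∧ K ≠ H} := (hfin.subset fun K hK => hK.1).to_subtype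
  obtain ⟨⟨K, hK, hne⟩, hK'⟩ := Subspace.exists_eq_top_of_iUnion_eq_univ (k := ℝ) (E := H)
    (p := fun K : {K // K ∈ 𝓗 ∧ K ≠ H} => K.1.comap H.subtype) (by
      refine Set.eq_univ_of_forall fun y => ?_
      obtain ⟨K, hK, hyK, hne⟩ := hcon y y.2
      exact Set.mem_iUnion.2 ⟨⟨K, hK, hne⟩, hyK⟩)
  refine hne (h K hK fun x hx => ?_)
  have : (⟨x, hx⟩ : H) ∈ K.comap H.subtype := by
    rw [hK']
    trivial
  exact this

section Chamber

variable {𝓗 : Set (Submodule ℝ V)} {C : Set V}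

theorem IsChamber.isPreconnected (hC : IsChamber 𝓗 C) : IsPreconnected C := by
  obtain ⟨x, -, rfl⟩ := hC
  exact isPreconnected_connectedComponentIn

theorem IsChamber.nonempty (hC : IsChamber 𝓗 C) : C.Nonempty := by
  obtain ⟨x, hx, rfl⟩ := hC
  exact ⟨x, mem_connectedComponentIn hx⟩

theorem IsChamber.subset (hC : IsChamber 𝓗 C) : C ⊆ arrangementComplement 𝓗 := by
  obtain ⟨x, -, rfl⟩ := hC
  exact connectedComponentIn_subset _ _

theorem IsChamber.mem_or_neg_mem_positiveRoots (hC : IsChamber 𝓗 C) {a : V} (ha : IsRoot 𝓗 a) :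
    a ∈ positiveRoots 𝓗 C ∨ -a ∈ positiveRoots 𝓗 C := by
  rcases forall_pos_or_forall_neg_of_isPreconnected hC.isPreconnected (a := a)
    (fun x hx h => hC.subset hx _ ha.2 (mem_perp.2 h)) with h | h
  · exact Or.inl ⟨ha, h⟩
  · exact Or.inr ⟨ha.neg, fun x hx => by simpa using h x hx⟩

theorem IsChamber.finite_positiveRoots (hC : IsChamber 𝓗 C) (hfin : 𝓗.Finite) :
    (positiveRoots 𝓗 C).Finite := by
  refine Set.Finite.of_injOn (f := fun a => (ℝ ∙ a)ᗮ) (fun a ha => ha.1.2) ?_ hfin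
  intro a ha b hb hab
  rcases eq_or_eq_neg_of_perp_le ha.1.1 hb.1.1 (show (ℝ ∙ a)ᗮ = (ℝ ∙ b)ᗮ from hab).le with h | h
  · exact h.symm
  · obtain ⟨x, hx⟩ := hC.nonempty
    have h1 := ha.2 x hx
    have h2 := hb.2 x hx
    rw [h, inner_neg_left] at h2
    linarith

variable [FiniteDimensional ℝ V]

theorem IsChamber.exists_positiveRoot (hC : IsChamber 𝓗 C) {H : Submodule ℝ V} (hH : H ∈ 𝓗)
    (hyp : IsHyperplane H) : ∃ a ∈ positiveRoots 𝓗 C, H = (ℝ ∙ a)ᗮ := by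
  obtain ⟨a, ha, rfl⟩ := hyp.exists_unit_normal
  rcases hC.mem_or_neg_mem_positiveRoots ⟨ha, hH⟩ with h | h
  · exact ⟨a, h, rfl⟩
  · exact ⟨-a, h, (perp_neg a).symm⟩

/-- The cone is convex, hence connected, and avoids every member of `𝓗`, so it cannot leave the
component `C`. -/
theorem IsChamber.eq_openCone (hC : IsChamber 𝓗 C) (h𝓗 : ∀ H ∈ 𝓗, IsHyperplane H) :
    C = openCone (positiveRoots 𝓗 C) := by
  refine Set.Subset.antisymm (fun x hx a ha => ha.2 x hx) ?_
  have hsub : openCone (positiveRoots 𝓗 C) ⊆ arrangementComplement 𝓗 := by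
    intro y hy H hH hyH
    obtain ⟨a, ha, rfl⟩ := hC.exists_positiveRoot hH (h𝓗 H hH)
    exact (hy a ha).ne' (mem_perp.1 hyH)
  have hx : ∃ x, x ∈ openCone (positiveRoots 𝓗 C) ∧
      C = connectedComponentIn (arrangementComplement 𝓗) x := by
    obtain ⟨x, hx, rfl⟩ := hC
    exact ⟨x, fun a ha => ha.2 x (mem_connectedComponentIn hx), rfl⟩
  obtain ⟨x, hx, hCx⟩ := hx
  have := (convex_openCone (positiveRoots 𝓗 C)).isPreconnected.subset_connectedComponentIn hx hsub
  exact this.trans hCx.symm.subset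

theorem refl_mem_reflectionGroup {H : Submodule ℝ V} (hH : H ∈ 𝓗) :
    refl H ∈ reflectionGroup 𝓗 :=
  Subgroup.subset_closure ⟨H, hH, rfl⟩

theorem finite_of_finite_reflectionGroup (hfin : Finite (reflectionGroup 𝓗)) : 𝓗.Finite := by
  have : Finite 𝓗 := Finite.of_injective
    (fun H : 𝓗 => (⟨refl H.1, refl_mem_reflectionGroup H.2⟩ : reflectionGroup 𝓗))
    fun H K h => Subtype.ext (refl_injective (congrArg Subtype.val h))
  exact Set.toFinite 𝓗

end Chamber

/-! ### Generation by wall reflections -/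

section Group

variable [FiniteDimensional ℝ V] {𝓗 : Set (Submodule ℝ V)} {C : Set V}

theorem inner_map_map_of_mem_reflectionGroup {w : V ≃ₗ[ℝ] V} (hw : w ∈ reflectionGroup 𝓗)
    (x y : V) : ⟪w x, w y⟫ = ⟪x, y⟫ := by
  induction hw using Subgroup.closure_induction generalizing x y with
  | mem w hw =>
    obtain ⟨H, -, rfl⟩ := hw
    exact inner_refl_refl H x y
  | one => rfl
  | mul v w _ _ hv hw => exact (hv _ _).trans (hw x y)
  | inv w _ hw =>
    have h := hw (w⁻¹ x) (w⁻¹ y)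
    exact h.symm.trans (congrArg₂ _ (w.apply_symm_apply x) (w.apply_symm_apply y))

theorem refl_perp_map {w : V ≃ₗ[ℝ] V} (hw : ∀ x y, ⟪w x, w y⟫ = ⟪x, y⟫) {a : V} (ha : ‖a‖ = 1) :
    refl (ℝ ∙ (w a))ᗮ = w * refl (ℝ ∙ a)ᗮ * w⁻¹ := by
  have hwa : ‖w a‖ = 1 := by
    have h := hw a a
    rwa [real_inner_self_eq_norm_sq, real_inner_self_eq_norm_sq, ha,
      sq_eq_sq₀ (norm_nonneg _) zero_le_one] at h
  ext v
  change _ = w (refl (ℝ ∙ a)ᗮ (w.symm v))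
  rw [refl_perp_apply hwa, refl_perp_apply ha, map_sub, map_smul, ← hw a (w.symm v),
    w.apply_symm_apply]

theorem IsRoot.map (hinv : IsInvariant (reflectionGroup 𝓗) 𝓗) {w : V ≃ₗ[ℝ] V}
    (hw : w ∈ reflectionGroup 𝓗) {a : V} (ha : IsRoot 𝓗 a) : IsRoot 𝓗 (w a) := by
  have hi := inner_map_map_of_mem_reflectionGroup hw
  refine ⟨?_, map_perp hi a ▸ hinv w hw _ ha.2⟩
  have h := hi a a
  rwa [real_inner_self_eq_norm_sq, real_inner_self_eq_norm_sq, ha.1,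
    sq_eq_sq₀ (norm_nonneg _) zero_le_one] at h

/-- The group generated by the wall reflections moves every point into the closed chamber. -/
theorem exists_mem_closure_walls_apply_mem (h𝓗 : ∀ H ∈ 𝓗, IsHyperplane H)
    (hfin : Finite (reflectionGroup 𝓗)) (hC : IsChamber 𝓗 C)
    (hle : Subgroup.closure {s | ∃ H, IsWall C H ∧ s = refl H} ≤ reflectionGroup 𝓗) (y : V) :
    ∃ w ∈ Subgroup.closure {s | ∃ H, IsWall C H ∧ s = refl H}, w y ∈ closure C := by
  have hA := hC.finite_positiveRoots (finite_of_finite_reflectionGroup hfin)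
  have hCA := hC.eq_openCone h𝓗
  obtain ⟨p, hp⟩ := hC.nonempty
  have hp' : p ∈ openCone (positiveRoots 𝓗 C) := hCA ▸ hp
  have hfin' : (Subgroup.closure {s | ∃ H, IsWall C H ∧ s = refl H} : Set (V ≃ₗ[ℝ] V)).Finite :=
    Set.Finite.subset (s := (reflectionGroup 𝓗 : Set (V ≃ₗ[ℝ] V))) hfin hle
  obtain ⟨w, hw, hmax⟩ := hfin'.exists_maximalFor (fun w => ⟪w y, p⟫) _ ⟨1, Subgroup.one_mem _⟩
  refine ⟨w, hw, ?_⟩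
  by_contra hwy
  rw [hCA] at hwy
  obtain ⟨a, ha, hwall, hneg⟩ := exists_isWall_inner_neg hA hp' hwy
  rw [← hCA] at hwall
  have hs : refl (ℝ ∙ a)ᗮ ∈ Subgroup.closure {s | ∃ H, IsWall C H ∧ s = refl H} :=
    Subgroup.subset_closure ⟨_, hwall, rfl⟩
  -- The increase is $-2\langle a, wy\rangle\langle a, p\rangle > 0$.
  have hlt : ⟪w y, p⟫ < ⟪(refl (ℝ ∙ a)ᗮ * w) y, p⟫ := by
    change _ < ⟪refl (ℝ ∙ a)ᗮ (w y), p⟫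
    rw [refl_perp_apply ha.1.1, inner_sub_left, inner_smul_left]
    have := mul_pos_of_neg_of_neg hneg (neg_lt_zero.2 (hp' a ha))
    simp only [conj_trivial]
    linarith
  exact (hmax (Subgroup.mul_mem _ hs hw) hlt.le).not_gt hlt

theorem closure_walls_eq_reflectionGroup (h𝓗 : ∀ H ∈ 𝓗, IsHyperplane H)
    (hfin : Finite (reflectionGroup 𝓗)) (hinv : IsInvariant (reflectionGroup 𝓗) 𝓗)
    (hC : IsChamber 𝓗 C) :
    Subgroup.closure {s | ∃ H, IsWall C H ∧ s = refl H} = reflectionGroup 𝓗 := by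
  have h𝓗f := finite_of_finite_reflectionGroup hfin
  have hA := hC.finite_positiveRoots h𝓗f
  have hCA := hC.eq_openCone h𝓗
  obtain ⟨p, hp⟩ := hC.nonempty
  have hp' : p ∈ openCone (positiveRoots 𝓗 C) := hCA ▸ hp
  have hle : Subgroup.closure {s | ∃ H, IsWall C H ∧ s = refl H} ≤ reflectionGroup 𝓗 := by
    rw [Subgroup.closure_le]
    rintro _ ⟨H, hH, rfl⟩
    rw [hCA] at hH
    obtain ⟨a, ha, rfl⟩ := hH.exists_eq_perp hA hp'
    exact refl_mem_reflectionGroup ha.1.2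
  refine le_antisymm hle ?_
  rw [reflectionGroup, Subgroup.closure_le]
  rintro _ ⟨H, hH, rfl⟩
  obtain ⟨a, ha, rfl⟩ := (h𝓗 H hH).exists_unit_normal
  obtain ⟨y, hy, hy'⟩ := exists_mem_forall_notMem h𝓗f (H := (ℝ ∙ a)ᗮ) fun K hK haK => by
    obtain ⟨b, hb, rfl⟩ := (h𝓗 K hK).exists_unit_normal
    rcases eq_or_eq_neg_of_perp_le ha hb haK with rfl | rfl
    · rfl
    · exact perp_neg a
  obtain ⟨w, hw, hwy⟩ := exists_mem_closure_walls_apply_mem h𝓗 hfin hC hle y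
  have hi := inner_map_map_of_mem_reflectionGroup (hle hw)
  have hroot : IsRoot 𝓗 (w a) := IsRoot.map hinv (hle hw) ⟨ha, hH⟩
  obtain ⟨b, hb, hab⟩ := hC.exists_positiveRoot hroot.2 (h𝓗 _ hroot.2)
  have hwall : IsWall C (ℝ ∙ (w a))ᗮ := by
    rw [hab]
    rw [hCA, closure_openCone hp'] at hwy
    have hbz : ⟪b, w y⟫ = 0 := by
      rw [← mem_perp, ← hab, mem_perp, hi, mem_perp.1 hy]
    have := isWall_openCone hA hp' hb hbz fun c hc hcb => (hwy c hc).lt_of_ne' fun h0 => hcb ?_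
    · rwa [← hCA] at this
    -- If `c` also vanished at `w y`, the hyperplane of `w⁻¹ c` would contain `y`, hence be that of
    -- `a`. Then `c = ±b`, and positivity on `C` leaves only `c = b`.
    have hv : IsRoot 𝓗 (w⁻¹ c) := IsRoot.map hinv (Subgroup.inv_mem _ (hle hw)) hc.1
    have hwv : w (w⁻¹ c) = c := w.apply_symm_apply c
    have h1 : (ℝ ∙ (w⁻¹ c))ᗮ = (ℝ ∙ a)ᗮ := hy' _ hv.2 (mem_perp.2 (by rw [← hi, hwv, h0]))
    have h2 : (ℝ ∙ c)ᗮ = (ℝ ∙ b)ᗮ := by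
      rw [← hab, ← map_perp hi, ← h1, map_perp hi, hwv]
    rcases eq_or_eq_neg_of_perp_le hc.1.1 hb.1.1 h2.le with h | h
    · exact h.symm
    · have h3 := hp' c hc
      have h4 := hp' b hb
      rw [h, inner_neg_left] at h4
      linarith
  have h1 : refl (ℝ ∙ a)ᗮ = w⁻¹ * refl (ℝ ∙ (w a))ᗮ * w := by
    rw [refl_perp_map hi ha]
    group
  rw [h1]
  exact Subgroup.mul_mem _ (Subgroup.mul_mem _ (Subgroup.inv_mem _ hw)
    (Subgroup.subset_closure ⟨_, hwall, rfl⟩)) hw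

end Group

/-! ### Dihedral geometry of two roots -/

/-- For unit vectors `a`, `b` with `⟪a, b⟫ = -cos t`, the unit vector of the plane spanned by `a`
and `b` at angle `x * t` from `-a`, so that `-a` and `b` are its values at `0` and `1`. -/
def dihedralVector (a b : V) (t x : ℝ) : V :=
  (Real.sin t)⁻¹ • (Real.sin (x * t) • b + Real.sin ((x - 1) * t) • a)

theorem dihedralVector_zero (a b : V) {t : ℝ} (ht : Real.sin t ≠ 0) :
    dihedralVector a b t 0 = -a := by
  simp [dihedralVector, smul_smul, ht]

theorem dihedralVector_one (a b : V) {t : ℝ} (ht : Real.sin t ≠ 0) :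
    dihedralVector a b t 1 = b := by
  simp [dihedralVector, smul_smul, ht]

theorem inner_dihedralVector_left {a b : V} {t : ℝ} (ha : ‖a‖ = 1) (hab : ⟪a, b⟫ = -Real.cos t)
    (ht : Real.sin t ≠ 0) (x : ℝ) : ⟪a, dihedralVector a b t x⟫ = -Real.cos (x * t) := by
  rw [dihedralVector, inner_smul_right, inner_add_right, inner_smul_right, inner_smul_right, hab,
    inner_self_of_norm_eq_one ha, sub_mul, one_mul, Real.sin_sub]
  field_simp
  ring

theorem inner_dihedralVector_right {a b : V} {t : ℝ} (hb : ‖b‖ = 1) (hab : ⟪a, b⟫ = -Real.cos t)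
    (ht : Real.sin t ≠ 0) (x : ℝ) : ⟪b, dihedralVector a b t x⟫ = Real.cos ((x - 1) * t) := by
  rw [dihedralVector, inner_smul_right, inner_add_right, inner_smul_right, inner_smul_right,
    real_inner_comm a b, hab, inner_self_of_norm_eq_one hb, sub_mul, one_mul, Real.sin_sub,
    Real.cos_sub]
  field_simp
  linear_combination (-Real.sin (x * t)) * Real.sin_sq_add_cos_sq t

section Dihedral

variable [FiniteDimensional ℝ V] {a b : V} {t : ℝ}

theorem refl_dihedralVector_left (ha : ‖a‖ = 1) (hab : ⟪a, b⟫ = -Real.cos t)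
    (ht : Real.sin t ≠ 0) (x : ℝ) :
    refl (ℝ ∙ a)ᗮ (dihedralVector a b t x) = -dihedralVector a b t (-x) := by
  rw [refl_perp_apply ha, inner_dihedralVector_left ha hab ht, dihedralVector, dihedralVector,
    show (-x - 1) * t = -(x * t + t) by ring, neg_mul, Real.sin_neg, Real.sin_neg, sub_mul, one_mul,
    Real.sin_sub, Real.sin_add]
  match_scalars <;> field_simp
  ring

theorem refl_dihedralVector_right (hb : ‖b‖ = 1) (hab : ⟪a, b⟫ = -Real.cos t)
    (ht : Real.sin t ≠ 0) (x : ℝ) :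
    refl (ℝ ∙ b)ᗮ (dihedralVector a b t x) = -dihedralVector a b t (2 - x) := by
  have h1 : Real.sin ((2 - x) * t) =
      2 * Real.sin t * Real.cos ((x - 1) * t) - Real.sin (x * t) := by
    rw [show (2 - x) * t = t - (x - 1) * t by ring, show x * t = t + (x - 1) * t by ring,
      Real.sin_sub, Real.sin_add]
    ring
  have h2 : Real.sin ((2 - x - 1) * t) = -Real.sin ((x - 1) * t) := by
    rw [← Real.sin_neg]
    ring_nf
  rw [refl_perp_apply hb, inner_dihedralVector_right hb hab ht, dihedralVector, dihedralVector,
    h1, h2]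
  match_scalars <;> field_simp
  ring

/-- Up to sign the two reflections act on the index by $x \mapsto -x$ and $x \mapsto 2 - x$. In the
product the signs cancel and the index shifts by 2. -/
theorem refl_mul_refl_pow_dihedralVector (ha : ‖a‖ = 1) (hb : ‖b‖ = 1)
    (hab : ⟪a, b⟫ = -Real.cos t) (ht : Real.sin t ≠ 0) (n : ℕ) (x : ℝ) :
    ((refl (ℝ ∙ b)ᗮ * refl (ℝ ∙ a)ᗮ) ^ n) (dihedralVector a b t x) =
      dihedralVector a b t (x + 2 * n) := by
  induction n with
  | zero => simp
  | succ n ih =>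
    rw [pow_succ']
    change refl (ℝ ∙ b)ᗮ (refl (ℝ ∙ a)ᗮ
      (((refl (ℝ ∙ b)ᗮ * refl (ℝ ∙ a)ᗮ) ^ n) (dihedralVector a b t x))) = _
    rw [ih, refl_dihedralVector_left ha hab ht, map_neg, refl_dihedralVector_right hb hab ht,
      neg_neg]
    congr 1
    push_cast
    ring

theorem orderOf_refl_mul_refl (ha : ‖a‖ = 1) (hb : ‖b‖ = 1) {m : ℕ} (hm : 2 ≤ m)
    (hab : ⟪a, b⟫ = -Real.cos (Real.pi / m)) :
    orderOf (refl (ℝ ∙ b)ᗮ * refl (ℝ ∙ a)ᗮ) = m := by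
  have hm0 : (m : ℝ) ≠ 0 := by positivity
  have ht : Real.sin (Real.pi / m) ≠ 0 := by
    refine (Real.sin_pos_of_pos_of_lt_pi (by positivity) (div_lt_self Real.pi_pos ?_)).ne'
    exact_mod_cast hm
  have hT := refl_mul_refl_pow_dihedralVector ha hb hab ht
  set T := refl (ℝ ∙ b)ᗮ * refl (ℝ ∙ a)ᗮ with hTdef
  refine Nat.dvd_antisymm (orderOf_dvd_of_pow_eq_one ?_) ?_
  -- A shift of the index by $2m$ is a full turn. Hence $T^m$ fixes the plane of `a` and `b`, while
  -- `T` already fixes its orthogonal complement.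
  · have hper : ∀ x, dihedralVector a b (Real.pi / m) (x + 2 * m) =
        dihedralVector a b (Real.pi / m) x := by
      intro x
      rw [dihedralVector, dihedralVector,
        show (x + 2 * m) * (Real.pi / m) = x * (Real.pi / m) + 2 * Real.pi by field_simp,
        show (x + 2 * m - 1) * (Real.pi / m) = (x - 1) * (Real.pi / m) + 2 * Real.pi by
          field_simp
          ring, Real.sin_add_two_pi, Real.sin_add_two_pi]
    have hTb : (T ^ m) b = b := by
      rw [← dihedralVector_one a b ht, hT, hper]
    have hTa : (T ^ m) a = a := by
      rw [← neg_inj, ← map_neg, ← dihedralVector_zero a b ht, hT, hper]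
    ext v
    obtain ⟨y, hy, z, hz, rfl⟩ :=
      (Submodule.span ℝ {a, b}).exists_add_mem_mem_orthogonal v
    have hTy : (T ^ m) y = y := by
      obtain ⟨α, β, rfl⟩ := Submodule.mem_span_pair.1 hy
      rw [map_add, map_smul, map_smul, hTa, hTb]
    have hza : ⟪a, z⟫ = 0 := hz a (Submodule.subset_span (by simp))
    have hzb : ⟪b, z⟫ = 0 := hz b (Submodule.subset_span (by simp))
    have hTz : T z = z := by
      change refl (ℝ ∙ b)ᗮ (refl (ℝ ∙ a)ᗮ z) = z
      rw [refl_apply_of_mem (mem_perp.2 hza), refl_apply_of_mem (mem_perp.2 hzb)]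
    have hTz' : ∀ n : ℕ, (T ^ n) z = z := by
      intro n
      induction n with
      | zero => rfl
      | succ n ih =>
        rw [pow_succ]
        change (T ^ n) (T z) = z
        rw [hTz, ih]
    change (T ^ m) (y + z) = y + z
    rw [map_add, hTy, hTz']
  -- Conversely, comparing the images of $-a$ through their inner products with `a` makes $2\pi
  -- \cdot \mathrm{ord}(T)/m$ a multiple of $2\pi$.
  · have h1 := hT (orderOf T) 0
    rw [pow_orderOf_eq_one] at h1
    have h2 := congrArg (fun v => ⟪a, v⟫) h1
    change ⟪a, dihedralVector a b (Real.pi / m) 0⟫ = _ at h2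
    simp only [inner_dihedralVector_left ha hab ht, neg_inj, zero_mul, Real.cos_zero,
      zero_add] at h2
    obtain ⟨k, hk⟩ := (Real.cos_eq_one_iff _).1 h2.symm
    have h3 : (k : ℝ) * m = orderOf T := by
      field_simp at hk
      linarith
    have h4 : (m : ℤ) ∣ orderOf T := ⟨k, by rw [mul_comm]; exact_mod_cast h3.symm⟩
    exact_mod_cast h4

/-- Even indices are rotated copies of $-a$, odd ones of $b$. -/
theorem IsRoot.dihedralVector {𝓗 : Set (Submodule ℝ V)}
    (hinv : IsInvariant (reflectionGroup 𝓗) 𝓗) (ha : IsRoot 𝓗 a) (hb : IsRoot 𝓗 b)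
    (hab : ⟪a, b⟫ = -Real.cos t) (ht : Real.sin t ≠ 0) (n : ℕ) :
    IsRoot 𝓗 (dihedralVector a b t n) := by
  have hmem (k : ℕ) : (refl (ℝ ∙ b)ᗮ * refl (ℝ ∙ a)ᗮ) ^ k ∈ reflectionGroup 𝓗 :=
    Subgroup.pow_mem _ (Subgroup.mul_mem _ (refl_mem_reflectionGroup hb.2)
      (refl_mem_reflectionGroup ha.2)) k
  rcases Nat.even_or_odd' n with ⟨k, rfl | rfl⟩
  · have h := refl_mul_refl_pow_dihedralVector ha.1 hb.1 hab ht k 0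
    rw [zero_add, dihedralVector_zero a b ht] at h
    rw [Nat.cast_mul, Nat.cast_two, ← h]
    exact ha.neg.map hinv (hmem k)
  · have h := refl_mul_refl_pow_dihedralVector ha.1 hb.1 hab ht k 1
    rw [dihedralVector_one a b ht] at h
    rw [Nat.cast_add, Nat.cast_mul, Nat.cast_two, Nat.cast_one, add_comm, ← h]
    exact hb.map hinv (hmem k)

end Dihedral

/-- Let $mt$ be the first multiple of $t$ with $mt \ge \pi$. If $mt > \pi$, then $\sin(mt) < 0 <
\sin((m-1)t)$, contradicting the hypothesis at $m$. -/
theorem exists_eq_pi_div_of_sin_mul_sin_nonneg {t : ℝ} (ht0 : 0 < t) (htpi : t < Real.pi)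
    (h : ∀ n : ℕ, 0 ≤ Real.sin (n * t) * Real.sin ((n - 1) * t)) :
    ∃ m : ℕ, 2 ≤ m ∧ t = Real.pi / m := by
  have h1 : Real.pi ≤ ⌈Real.pi / t⌉₊ * t := (div_le_iff₀ ht0).1 (Nat.le_ceil _)
  have h2 : (⌈Real.pi / t⌉₊ - 1) * t < Real.pi := by
    rw [← lt_div_iff₀ ht0, sub_lt_iff_lt_add]
    exact Nat.ceil_lt_add_one (by positivity)
  have hm : 2 ≤ ⌈Real.pi / t⌉₊ := by
    rw [Nat.succ_le_iff, Nat.lt_ceil, Nat.cast_one, one_lt_div ht0]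
    exact htpi
  refine ⟨_, hm, ?_⟩
  generalize ⌈Real.pi / t⌉₊ = m at *
  have hm' : (2 : ℝ) ≤ m := by exact_mod_cast hm
  rw [eq_div_iff (by positivity), mul_comm]
  refine le_antisymm (le_of_not_gt fun hlt => (h m).not_gt ?_) h1
  refine mul_neg_of_neg_of_pos ?_ (Real.sin_pos_of_pos_of_lt_pi (mul_pos (by linarith) ht0) h2)
  rw [← Real.sin_sub_two_pi]
  exact Real.sin_neg_of_neg_of_neg_pi_lt (by linarith) (by linarith)

/-! ### Angles between walls -/

section Walls

variable {C : Set V}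

theorem inner_nonneg_of_mem_closure {e : V} (he : ∀ x ∈ C, 0 < ⟪e, x⟫) {x : V}
    (hx : x ∈ closure C) : 0 ≤ ⟪e, x⟫ := by
  have h : closure C ⊆ {x | 0 ≤ ⟪e, x⟫} :=
    closure_minimal (fun x hx => (he x hx).le) (isClosed_le continuous_const (by fun_prop))
  exact h hx

theorem IsInwardUnitNormal.eq_perp [FiniteDimensional ℝ V] {H : Submodule ℝ V} {e : V}
    (he : IsInwardUnitNormal C H e) (hH : IsHyperplane H) : H = (ℝ ∙ e)ᗮ := by
  obtain ⟨a, ha, rfl⟩ := hH.exists_unit_normal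
  have hle : (ℝ ∙ a)ᗮ ≤ (ℝ ∙ e)ᗮ := fun x hx => mem_perp.2 ((real_inner_comm _ _).trans (he.1 x hx))
  rcases eq_or_eq_neg_of_perp_le ha he.2.1 hle with rfl | rfl
  · rfl
  · exact (perp_neg a).symm

/-- A wall contains a point of the closed chamber on which a second wall normal is positive. -/
theorem IsWall.exists_inner_pos {a b : V} (ha : ‖a‖ = 1) (hb : ‖b‖ = 1)
    (hbC : ∀ x ∈ C, 0 < ⟪b, x⟫) (hH : IsWall C (ℝ ∙ a)ᗮ) (hne : (ℝ ∙ a)ᗮ ≠ (ℝ ∙ b)ᗮ) :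
    ∃ p ∈ closure C, ⟪a, p⟫ = 0 ∧ 0 < ⟪b, p⟫ := by
  obtain ⟨-, F, hFne, hF, hspan⟩ := hH
  obtain ⟨l, hl⟩ := hF hFne
  have hFC : F ⊆ closure C := by
    rw [hl]
    exact Set.sep_subset _ _
  by_contra! hcon
  refine hne ?_
  have hle : (ℝ ∙ a)ᗮ ≤ (ℝ ∙ b)ᗮ := by
    rw [← hspan, Submodule.span_le]
    intro x hx
    have hxa : x ∈ (ℝ ∙ a)ᗮ := hspan ▸ Submodule.subset_span hx
    exact mem_perp.2 (le_antisymm (hcon x (hFC hx) (mem_perp.1 hxa))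
      (inner_nonneg_of_mem_closure hbC (hFC hx)))
  rcases eq_or_eq_neg_of_perp_le ha hb hle with rfl | rfl
  · rfl
  · exact (perp_neg a).symm

/-- Take `p`, `q` in the closed chamber, one on each wall but not on the other. The root of index
$n$ pairs with them as positive multiples of $\sin(nt)$ and $\sin((n-1)t)$. Having constant sign on
`C`, it cannot give these opposite signs. -/
theorem inner_eq_neg_cos_pi_div_orderOf [FiniteDimensional ℝ V] {𝓗 : Set (Submodule ℝ V)}
    (hinv : IsInvariant (reflectionGroup 𝓗) 𝓗) (hC : IsChamber 𝓗 C) {a b : V}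
    (ha : a ∈ positiveRoots 𝓗 C) (hb : b ∈ positiveRoots 𝓗 C) (haw : IsWall C (ℝ ∙ a)ᗮ)
    (hbw : IsWall C (ℝ ∙ b)ᗮ) (hne : (ℝ ∙ a)ᗮ ≠ (ℝ ∙ b)ᗮ) :
    ⟪a, b⟫ = -Real.cos (Real.pi / (orderOf (refl (ℝ ∙ b)ᗮ * refl (ℝ ∙ a)ᗮ) : ℝ)) := by
  obtain ⟨p, hp, hap, hbp⟩ := haw.exists_inner_pos ha.1.1 hb.1.1 hb.2 hne
  obtain ⟨q, hq, hbq, haq⟩ := hbw.exists_inner_pos hb.1.1 ha.1.1 ha.2 hne.symm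
  have hlt : ⟪a, b⟫ < 1 := (inner_lt_one_iff_real_of_norm_eq_one ha.1.1 hb.1.1).2
    fun h => hne (by rw [h])
  have hgt : -1 < ⟪a, b⟫ := by
    have h := (inner_lt_one_iff_real_of_norm_eq_one (norm_neg a ▸ ha.1.1 : ‖-a‖ = 1) hb.1.1).2
      fun h => hne (by rw [← h, perp_neg])
    rw [inner_neg_left] at h
    linarith
  obtain ⟨t, ht0, htpi, hab⟩ : ∃ t, 0 < t ∧ t < Real.pi ∧ ⟪a, b⟫ = -Real.cos t := by
    refine ⟨Real.arccos (-⟪a, b⟫), Real.arccos_pos.2 (by linarith), ?_, ?_⟩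
    · rw [Real.arccos_neg, sub_lt_self_iff]
      exact Real.arccos_pos.2 hlt
    · rw [Real.cos_arccos (by linarith) (by linarith), neg_neg]
  have hsin := Real.sin_pos_of_pos_of_lt_pi ht0 htpi
  obtain ⟨m, hm, rfl⟩ := exists_eq_pi_div_of_sin_mul_sin_nonneg ht0 htpi fun n => by
    have hroot := IsRoot.dihedralVector hinv ha.1 hb.1 hab hsin.ne' n
    have hip : ⟪dihedralVector a b t n, p⟫ = (Real.sin t)⁻¹ * (Real.sin (n * t) * ⟪b, p⟫) := by
      simp [dihedralVector, inner_smul_left, inner_add_left, hap]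
    have hiq : ⟪dihedralVector a b t n, q⟫ =
        (Real.sin t)⁻¹ * (Real.sin ((n - 1) * t) * ⟪a, q⟫) := by
      simp [dihedralVector, inner_smul_left, inner_add_left, hbq]
    have hpq : 0 ≤ ⟪dihedralVector a b t n, p⟫ * ⟪dihedralVector a b t n, q⟫ := by
      rcases hC.mem_or_neg_mem_positiveRoots hroot with h | h
      · exact mul_nonneg (inner_nonneg_of_mem_closure h.2 hp) (inner_nonneg_of_mem_closure h.2 hq)
      · rw [← neg_mul_neg, ← inner_neg_left, ← inner_neg_left]
        exact mul_nonneg (inner_nonneg_of_mem_closure h.2 hp) (inner_nonneg_of_mem_closure h.2 hq)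
    rw [hip, hiq] at hpq
    have hpos : 0 < (Real.sin t)⁻¹ * (Real.sin t)⁻¹ * (⟪b, p⟫ * ⟪a, q⟫) := by positivity
    refine nonneg_of_mul_nonneg_left (a := Real.sin (n * t) * Real.sin ((n - 1) * t)) ?_ hpos
    exact hpq.trans_eq (by ring)
  rw [orderOf_refl_mul_refl ha.1.1 hb.1.1 hm hab, hab]

end Walls

end ReflectionChambers

end

theorem mainTheorem1 {V : Type*} [NormedAddCommGroup V] [InnerProductSpace ℝ V]
    [FiniteDimensional ℝ V]
    (𝓗 : Set (Submodule ℝ V))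
    (h𝓗 : ∀ H ∈ 𝓗, ReflectionChambers.IsHyperplane H)
    (hfin : Finite (ReflectionChambers.reflectionGroup 𝓗))
    (hinv : ReflectionChambers.IsInvariant (ReflectionChambers.reflectionGroup 𝓗) 𝓗)
    (C : Set V) (hC : ReflectionChambers.IsChamber 𝓗 C) :
    Subgroup.closure {s | ∃ H, ReflectionChambers.IsWall C H ∧ s = ReflectionChambers.refl H} =
        ReflectionChambers.reflectionGroup 𝓗 ∧
      ∀ (r : ℕ) (H : Fin r → Submodule ℝ V) (e : Fin r → V),
        Module.finrank ℝ V = r →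
        Function.Injective H →
        Set.range H = {K | ReflectionChambers.IsWall C K} →
        (∀ i, ReflectionChambers.IsInwardUnitNormal C (H i) (e i)) →
        ∀ i j, ⟪e i, e j⟫ = -Real.cos (Real.pi /
          (orderOf (ReflectionChambers.refl (H i) * ReflectionChambers.refl (H j)) : ℝ)) := by
  refine ⟨ReflectionChambers.closure_walls_eq_reflectionGroup h𝓗 hfin hinv hC, ?_⟩
  intro r H e _ hinj hrange he i j
  have hwall : ∀ k, ReflectionChambers.IsWall C (H k) := fun k =>
    hrange.subset (Set.mem_range_self k)
  have hH : ∀ k, H k = (ℝ ∙ (e k))ᗮ := fun k => (he k).eq_perp (hwall k).1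
  by_cases hij : i = j
  · subst hij
    -- On the diagonal the order is 1 and $-\cos\pi = 1$.
    rw [ReflectionChambers.refl_mul_self, orderOf_one,
      ReflectionChambers.inner_self_of_norm_eq_one (he i).2.1]
    simp
  -- Every wall is a member of `𝓗`, so its inward unit normal is a root.
  have hpos : ∀ k, e k ∈ ReflectionChambers.positiveRoots 𝓗 C := by
    intro k
    have hA := hC.finite_positiveRoots (ReflectionChambers.finite_of_finite_reflectionGroup hfin)
    have hCA := hC.eq_openCone h𝓗
    obtain ⟨p, hp⟩ := hC.nonempty
    have hw := hwall k
    rw [hCA] at hw hp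
    obtain ⟨a, ha, hka⟩ := hw.exists_eq_perp hA hp
    exact ⟨⟨(he k).2.1, by rw [← hH, hka]; exact ha.1.2⟩, (he k).2.2⟩
  rw [real_inner_comm, hH i, hH j]
  refine ReflectionChambers.inner_eq_neg_cos_pi_div_orderOf hinv hC (hpos j) (hpos i)
    (hH j ▸ hwall j) (hH i ▸ hwall i) ?_
  rw [← hH, ← hH]
  exact fun h => hij (hinj h).symm
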